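/- Let $\mathcal{G}_{n,d}$ be the set of all $d$-regular (simple, labelled) graphs with vertex set $[n]=\{1,\dots,n\}$. Let $v,w,x,y,z$ be five distinct vertices of a graph $G$. If $yx,xv,vw,wz$ are edges of $G$ and $xw,yz$ are not, a make triangle switch deletes the edges $xy,wz$ and inserts the edges $xw,yz$. If $yz$ and the three edges of the triangle on $v,x,w$ are edges of $G$ and $xy,wz$ are not, a break triangle switch deletes the edges $xw,yz$ and inserts the edges $xy,wz$. A $\Delta$-switch is a make or a break triangle switch. Let $\mathcal{M}_{n,d}$ be the graph with vertex set $\mathcal{G}_{n,d}$ in which $G$ and $G'$ are adjacent if and only if $G'$ can be obtained from $G$ by a single $\Delta$-switch (this relation is symmetric and irreflexive). A $\Delta$-switch chain is a time-homogeneous Markov chain with state space $\mathcal{G}_{n,d}$ whose transition matrix $P$ satisfies, for all $G\neq G'$, $P(G,G')>0$ if and only if $G$ and $G'$ are adjacent in $\mathcal{M}_{n,d}$. **Theorem.** Let $d\ge 3$ and $n\ge 0$ be integers. If $\mathcal{G}_{n,d}$ is non-empty, then the graph $\mathcal{M}_{n,d}$ is connected. Equivalently, every $\Delta$-switch chain is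 irreducible on $\mathcal{G}_{n,d}$. -/

import Mathlib

namespace TriangleSwitch

/-- `G'` is obtained from `G` by a make triangle switch: the 4-edge path `y x v w z`
(on five distinct vertices) is present in `G`, the edges `xw` and `yz` are absent,
and `xy`, `wz` are replaced by `xw`, `yz`. -/
def MakeSwitch {V : Type*} (G G' : SimpleGraph V) : Prop :=
  ∃ v w x y z : V, [v, w, x, y, z].Nodup ∧
    G.Adj y x ∧ G.Adj x v ∧ G.Adj v w ∧ G.Adj w z ∧ ¬ G.Adj x w ∧ ¬ G.Adj y z ∧
    G'.edgeSet = (G.edgeSet \ {s(x, y), s(w, z)}) ∪ {s(x, w), s(y, z)}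

/-- `G'` is obtained from `G` by a break triangle switch: the edge `yz` and the triangle on
`v`, `x`, `w` (five distinct vertices) are present in `G`, the edges `xy` and `wz` are absent,
and `xw`, `yz` are replaced by `xy`, `wz`. -/
def BreakSwitch {V : Type*} (G G' : SimpleGraph V) : Prop :=
  ∃ v w x y z : V, [v, w, x, y, z].Nodup ∧
    G.Adj y z ∧ G.Adj v x ∧ G.Adj x w ∧ G.Adj w v ∧ ¬ G.Adj x y ∧ ¬ G.Adj w z ∧
    G'.edgeSet = (G.edgeSet \ {s(x, w), s(y, z)}) ∪ {s(x, y), s(w, z)}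

/-- `G'` is obtained from `G` by a single triangle switch. -/
def Switch {V : Type*} (G G' : SimpleGraph V) : Prop :=
  MakeSwitch G G' ∨ BreakSwitch G G'

theorem edgeSet_reverse {α : Type*} {E E' : Set α} {a b c d : α}
    (ha : a ∈ E) (hb : b ∈ E) (hc : c ∉ E) (hd : d ∉ E)
    (h : E' = (E \ {a, b}) ∪ {c, d}) : E = (E' \ {c, d}) ∪ {a, b} := by
  subst h
  ext e
  simp only [Set.mem_union, Set.mem_sdiff, Set.mem_insert_iff, Set.mem_singleton_iff]
  grind

theorem MakeSwitch.reverse {V : Type*} {G G' : SimpleGraph V} (h : MakeSwitch G G') :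
    BreakSwitch G' G := by
  obtain ⟨v, w, x, y, z, hn, hyx, hxv, hvw, hwz, hxw, hyz, hE⟩ := h
  have key : ∀ a b, G'.Adj a b ↔ s(a, b) ∈ (G.edgeSet \ {s(x, y), s(w, z)}) ∪ {s(x, w), s(y, z)} :=
    fun a b => by rw [← hE, SimpleGraph.mem_edgeSet]
  have hrev := edgeSet_reverse (a := s(x, y)) (b := s(w, z)) (c := s(x, w)) (d := s(y, z))
    hyx.symm hwz hxw hyz hE
  simp only [Set.mem_union, Set.mem_sdiff, Set.mem_insert_iff, Set.mem_singleton_iff,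
    SimpleGraph.mem_edgeSet, Sym2.eq_iff] at key
  have := hxv.symm
  have := hvw.symm
  refine ⟨v, w, x, y, z, hn, ?_, ?_, ?_, ?_, ?_, ?_, hrev⟩ <;> rw [key] <;>
    simp only [List.nodup_cons, List.mem_cons, List.not_mem_nil] at hn <;> grind

theorem BreakSwitch.reverse {V : Type*} {G G' : SimpleGraph V} (h : BreakSwitch G G') :
    MakeSwitch G' G := by
  obtain ⟨v, w, x, y, z, hn, hyz, hvx, hxw, hwv, hxy, hwz, hE⟩ := h
  have key : ∀ a b, G'.Adj a b ↔ s(a, b) ∈ (G.edgeSet \ {s(x, w), s(y, z)}) ∪ {s(x, y), s(w, z)} :=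
    fun a b => by rw [← hE, SimpleGraph.mem_edgeSet]
  have hrev := edgeSet_reverse (a := s(x, w)) (b := s(y, z)) (c := s(x, y)) (d := s(w, z))
    hxw hyz hxy hwz hE
  simp only [Set.mem_union, Set.mem_sdiff, Set.mem_insert_iff, Set.mem_singleton_iff,
    SimpleGraph.mem_edgeSet, Sym2.eq_iff] at key
  have := hvx.symm
  have := hwv.symm
  refine ⟨v, w, x, y, z, hn, ?_, ?_, ?_, ?_, ?_, ?_, hrev⟩ <;> rw [key] <;>
    simp only [List.nodup_cons, List.mem_cons, List.not_mem_nil] at hn <;> grind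

theorem Switch.symm {V : Type*} {G G' : SimpleGraph V} (h : Switch G G') : Switch G' G :=
  h.elim (fun h => Or.inr h.reverse) (fun h => Or.inl h.reverse)

theorem MakeSwitch.ne {V : Type*} {G G' : SimpleGraph V} (h : MakeSwitch G G') : G ≠ G' := by
  rintro rfl
  obtain ⟨v, w, x, y, z, -, -, -, -, -, hxw, -, hE⟩ := h
  apply hxw
  rw [← SimpleGraph.mem_edgeSet, hE]
  simp

theorem Switch.ne {V : Type*} {G G' : SimpleGraph V} (h : Switch G G') : G ≠ G' :=
  h.elim (fun h => h.ne) (fun h => h.reverse.ne.symm)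

open Classical in
/-- The labelled `d`-regular graphs with vertex set `Fin n` (which stands for `{1, …, n}`). -/
abbrev RegularGraph (n d : ℕ) : Type :=
  {G : SimpleGraph (Fin n) // G.IsRegularOfDegree d}

/-- The graph on the labelled `d`-regular graphs on `n` vertices in which two of them are adjacent
if and only if one is obtained from the other by a single triangle switch. -/
def switchGraph (n d : ℕ) : SimpleGraph (RegularGraph n d) where
  Adj G G' := Switch G.1 G'.1
  symm := ⟨fun _ _ h => h.symm⟩
  loopless := ⟨fun _ h => h.ne rfl⟩

open Classical in
/-- `P` is the transition matrix of a (time-homogeneous) Markov chain on the labelled `d`-regular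
graphs whose transitions between distinct states are exactly the triangle switches.
Holding probabilities `P G G` are unrestricted. -/
structure IsSwitchChain {n d : ℕ} (P : Matrix (RegularGraph n d) (RegularGraph n d) ℝ) : Prop where
  stochastic : P ∈ Matrix.rowStochastic ℝ (RegularGraph n d)
  pos_iff : ∀ G G' : RegularGraph n d, G ≠ G' → (0 < P G G' ↔ (switchGraph n d).Adj G G')

end TriangleSwitch

/-! An ordinary switch exchanges the edges and non-edges of an alternating 4-cycle, and is a
triangle switch when a further vertex is joined to two consecutive vertices of the cycle. Two
distinct `d`-regular graphs can always be brought closer by an ordinary switch in one of them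
(`Reg.exists_closer`). So inside any class of graphs where every such switch can be simulated by
triangle switches, all members are connected (`reach_of_forall_alt`).

If `n ≤ 2d + 1`, there is no room for a 4-cycle whose switch cannot be simulated: the outside
neighbourhoods of its vertices would have to be disjoint, which counting and parity forbid
(`Alt.reach_of_card_le`).

If `n ≥ 2d + 2`, both graphs are moved to graphs having a clique component on one prescribed set of
`d + 1` vertices. A triangle is created (`Reg.exists_triangle`), the neighbourhood of one of its
vertices is made denser until it is a clique (`Reg.grows`), and the resulting component is relocated
one vertex at a time (`Reg.reach_cliqueComponent_of_card_eq`). As `d + 1 ≥ 4`, the common component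
contains a `K₄`, which is a catalyst for any switch elsewhere (`Alt.reach_of_hub`). -/

namespace TriangleSwitch

/-! ### Alternating 4-cycles and their switches -/

section

variable {V : Type*} {G G' H : SimpleGraph V}

/-- The edges `xy`, `zw` are replaced by `yz`, `wx`. -/
def swap (G : SimpleGraph V) (x y z w : V) : SimpleGraph V :=
  SimpleGraph.fromEdgeSet ((G.edgeSet \ {s(x, y), s(z, w)}) ∪ {s(y, z), s(w, x)})

/-- `x y z w` is an alternating 4-cycle, with edges `xy`, `zw` and non-edges `yz`, `wx`. -/
structure Alt (G : SimpleGraph V) (x y z w : V) : Prop where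
  xy : G.Adj x y
  zw : G.Adj z w
  yz : ¬ G.Adj y z
  wx : ¬ G.Adj w x
  hyz : y ≠ z
  hwx : w ≠ x

theorem Alt.hxz {x y z w : V} (h : Alt G x y z w) : x ≠ z := fun e =>
  h.yz (e ▸ h.xy.symm)

theorem Alt.hyw {x y z w : V} (h : Alt G x y z w) : y ≠ w := fun e =>
  h.yz (e ▸ h.zw.symm)

theorem Alt.rotate {x y z w : V} (h : Alt G x y z w) : Alt G z w x y :=
  ⟨h.zw, h.xy, h.wx, h.yz, h.hwx, h.hyz⟩

theorem Alt.reflect {x y z w : V} (h : Alt G x y z w) : Alt G y x w z :=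
  ⟨h.xy.symm, h.zw.symm, fun e => h.wx e.symm, fun e => h.yz e.symm, h.hwx.symm, h.hyz.symm⟩

theorem swap_rotate (G : SimpleGraph V) (x y z w : V) : swap G x y z w = swap G z w x y := by
  simp only [swap, Set.pair_comm]

theorem swap_reflect (G : SimpleGraph V) (x y z w : V) : swap G x y z w = swap G y x w z := by
  simp only [swap, Set.pair_comm, Sym2.eq_swap]

theorem swap_adj {x y z w p q : V} (h : Alt G x y z w) :
    (swap G x y z w).Adj p q ↔
      (G.Adj p q ∧ ¬ (p = x ∧ q = y) ∧ ¬ (p = y ∧ q = x) ∧ ¬ (p = z ∧ q = w) ∧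
        ¬ (p = w ∧ q = z)) ∨ (p = y ∧ q = z) ∨ (p = z ∧ q = y) ∨ (p = w ∧ q = x) ∨
        (p = x ∧ q = w) := by
  have h1 := h.hyz
  have h2 := h.hwx
  have h3 := @SimpleGraph.irrefl _ G p
  simp only [swap, SimpleGraph.fromEdgeSet_adj, Set.mem_union, Set.mem_sdiff, Set.mem_insert_iff,
    Set.mem_singleton_iff, SimpleGraph.mem_edgeSet, Sym2.eq_iff]
  grind

theorem edgeSet_swap {x y z w : V} (h : Alt G x y z w) :
    (swap G x y z w).edgeSet = (G.edgeSet \ {s(x, y), s(z, w)}) ∪ {s(y, z), s(w, x)} := by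
  rw [swap, SimpleGraph.edgeSet_fromEdgeSet]
  refine sdiff_eq_left.2 (Set.disjoint_left.2 fun e he => ?_)
  have h1 := h.hyz
  have h2 := h.hwx
  rcases he with he | rfl | rfl
  · exact G.not_isDiag_of_mem_edgeSet he.1
  · simpa using h1
  · simpa using h2

theorem swap_adj' {x y z w p q : V} (h : Alt G x y z w) :
    (swap G x y z w).Adj p q ↔
      (G.Adj p q ∧ s(p, q) ≠ s(x, y) ∧ s(p, q) ≠ s(z, w)) ∨ s(p, q) = s(y, z) ∨
        s(p, q) = s(w, x) := by
  rw [← SimpleGraph.mem_edgeSet, edgeSet_swap h]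
  simp only [Set.mem_union, Set.mem_sdiff, Set.mem_insert_iff, Set.mem_singleton_iff, not_or,
    SimpleGraph.mem_edgeSet, ne_eq]

/-- Reachability by triangle switches. -/
def Reach (G G' : SimpleGraph V) : Prop := Relation.ReflTransGen Switch G G'

theorem Reach.refl (G : SimpleGraph V) : Reach G G := Relation.ReflTransGen.refl

theorem Reach.trans (h : Reach G G') (h' : Reach G' H) : Reach G H :=
  Relation.ReflTransGen.trans h h'

theorem Reach.symm (h : Reach G G') : Reach G' G :=
  (@Relation.ReflTransGen.stdSymm _ Switch ⟨fun _ _ h => h.symm⟩).symm _ _ h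

theorem Alt.makeSwitch {x y z w v : V} (h : Alt G x y z w) (hx : G.Adj v x) (hw : G.Adj v w)
    (hy : v ≠ y) (hz : v ≠ z) : MakeSwitch G (swap G x y z w) := by
  refine ⟨v, w, x, y, z, ?_, h.xy.symm, hx.symm, hw, h.zw.symm, fun e => h.wx e.symm, h.yz, ?_⟩
  · have := h.hyz
    have := h.hwx
    have := h.hxz
    have := h.hyw
    have := h.xy.ne
    have := h.zw.ne
    have := hx.ne
    have := hw.ne
    simp only [List.nodup_cons, List.mem_cons, List.not_mem_nil]
    grind
  · rw [edgeSet_swap h, Sym2.eq_swap (a := w) (b := z), Sym2.eq_swap (a := x) (b := w),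
      Set.pair_comm s(y, z)]

theorem Alt.breakSwitch {x y z w v : V} (h : Alt G x y z w) (hx : G.Adj v x) (hy : G.Adj v y)
    (hz : v ≠ z) (hw : v ≠ w) : BreakSwitch G (swap G x y z w) := by
  refine ⟨v, y, x, w, z, ?_, h.zw.symm, hx, h.xy, hy.symm, fun e => h.wx e.symm, h.yz, ?_⟩
  · have := h.hyz
    have := h.hwx
    have := h.hxz
    have := h.hyw
    have := h.xy.ne
    have := h.zw.ne
    have := hx.ne
    have := hy.ne
    simp only [List.nodup_cons, List.mem_cons, List.not_mem_nil]
    grind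
  · rw [edgeSet_swap h, Sym2.eq_swap (a := w) (b := z), Sym2.eq_swap (a := x) (b := w),
      Set.pair_comm s(y, z)]

theorem Alt.reach_make {x y z w v : V} (h : Alt G x y z w) (hx : G.Adj v x) (hw : G.Adj v w)
    (hy : v ≠ y) (hz : v ≠ z) : Reach G (swap G x y z w) :=
  .single (.inl (h.makeSwitch hx hw hy hz))

theorem Alt.reach_break {x y z w v : V} (h : Alt G x y z w) (hx : G.Adj v x) (hy : G.Adj v y)
    (hz : v ≠ z) (hw : v ≠ w) : Reach G (swap G x y z w) :=
  .single (.inr (h.breakSwitch hx hy hz hw))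

theorem Switch.exists_alt (h : Switch G G') :
    ∃ x y z w, Alt G x y z w ∧ G' = swap G x y z w := by
  rcases h with ⟨v, w, x, y, z, hn, hyx, hxv, hvw, hwz, hxw, hyz, hE⟩ |
    ⟨v, w, x, y, z, hn, hyz, hvx, hxw, hwv, hxy, hwz, hE⟩ <;>
  simp only [List.nodup_cons, List.mem_cons, List.not_mem_nil] at hn
  · have ha : Alt G x y z w := ⟨hyx.symm, hwz.symm, hyz, fun e => hxw e.symm, by grind, by grind⟩
    refine ⟨x, y, z, w, ha, SimpleGraph.edgeSet_injective ?_⟩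
    rw [edgeSet_swap ha, hE, Sym2.eq_swap (a := w) (b := z), Sym2.eq_swap (a := x) (b := w),
      Set.pair_comm s(y, z)]
  · have ha : Alt G x w z y := ⟨hxw, hyz.symm, hwz, fun e => hxy e.symm, by grind, by grind⟩
    refine ⟨x, w, z, y, ha, SimpleGraph.edgeSet_injective ?_⟩
    rw [edgeSet_swap ha, hE, Sym2.eq_swap (a := y) (b := z), Sym2.eq_swap (a := x) (b := y),
      Set.pair_comm s(w, z)]

/-- Replaces `ay`, `qp` by `yq`, `pa` with the help of a triangle on `a`, `c`, `h`. -/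
theorem Alt.reach_slide {a y q p c h : V} (hA : Alt G a y q p) (hac : G.Adj a c)
    (hha : G.Adj h a) (hhc : G.Adj h c) (hcq : ¬ G.Adj c q) (hcy : c ≠ y) (hne : c ≠ q)
    (hhy : h ≠ y) (hhq : h ≠ q) : Reach G (swap G a y q p) := by
  have h0 := hA.xy
  have h1 := hA.zw
  have h2 := hA.yz
  have h3 := hA.wx
  have h4 := hA.hyz
  have h5 := hA.hwx
  have hB : Alt G a c q p := ⟨hac, h1, hcq, h3, hne, h5⟩
  have hhp : h ≠ p := by rintro rfl; exact h3 hha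
  have hcp : c ≠ p := by rintro rfl; exact h3 hac.symm
  have haq := hA.hxz
  have hyp := hA.hyw
  have hn1 := h0.ne
  have hn2 := h1.ne
  have hn3 := hac.ne
  have hn4 := hha.ne
  have hn5 := hhc.ne
  -- The break switch trades `ac`, `qp` for `cq`, `pa`; now a make switch centred at `h` trades
  -- `ay`, `qc` for `yq`, `ca`, so that `ac` is restored.
  have hC : Alt (swap G a c q p) a y q c := by
    constructor <;> (try rw [swap_adj hB]) <;> grind
  have e : swap (swap G a c q p) a y q c
      = swap G a y q p := by
    ext s t
    rw [swap_adj' hC, swap_adj' hB, swap_adj' hA]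
    have : s(a, y) ≠ s(a, c) := by simp; grind
    have : s(a, y) ≠ s(q, p) := by simp; grind
    have : s(c, q) ≠ s(a, y) := by simp; grind
    have : s(p, a) ≠ s(a, y) := by simp; grind
    have : s(p, a) ≠ s(q, c) := by simp; grind
    have : s(q, p) ≠ s(a, c) := by simp; grind
    have e1 : s(q, c) = s(c, q) := Sym2.eq_swap
    have e2 : s(c, a) = s(a, c) := Sym2.eq_swap
    rw [e1, e2]
    simp only [← SimpleGraph.mem_edgeSet] at *
    grind
  rw [← e]
  refine (hB.reach_break hha hhc hhq hhp).trans (hC.reach_make (v := h) ?_ ?_ hhy hhq)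
  all_goals rw [swap_adj hB]; grind

end

/-! ### Distance between regular graphs and reduction to single switches -/

section

variable {V : Type*} [Fintype V] {G G' H : SimpleGraph V} {d : ℕ}

open Classical in
/-- The finset of neighbours of `v`. -/
noncomputable def nb (G : SimpleGraph V) (v : V) : Finset V := Finset.univ.filter (G.Adj v)

theorem mem_nb {v w : V} : w ∈ nb G v ↔ G.Adj v w := by simp [nb]

/-- Every vertex has exactly `d` neighbours. -/
def Reg (G : SimpleGraph V) (d : ℕ) : Prop := ∀ v, (nb G v).card = d

theorem Reg.card_nb_swap (hG : Reg G d) {x y z w : V} (h : Alt G x y z w) :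
    (nb (swap G x y z w) x).card = d := by
  classical
  have h1 := h.hyz
  have h2 := h.hwx
  have h3 := h.hxz
  have h4 := h.hyw
  have h5 := h.xy.ne
  have h6 := h.zw.ne
  have e : nb (swap G x y z w) x = insert w ((nb G x).erase y) := by
    ext q
    simp only [mem_nb, swap_adj h, Finset.mem_insert, Finset.mem_erase]
    grind
  have hy : y ∈ nb G x := mem_nb.2 h.xy
  have hw : w ∉ (nb G x).erase y := fun hw =>
    h.wx (mem_nb.1 (Finset.mem_of_mem_erase hw)).symm
  rw [e, Finset.card_insert_of_notMem hw, Finset.card_erase_add_one hy, hG]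

theorem Reg.swap (hG : Reg G d) {x y z w : V} (h : Alt G x y z w) :
    Reg (swap G x y z w) d := by
  intro v
  by_cases hx : v = x
  · rw [hx]; exact hG.card_nb_swap h
  by_cases hy : v = y
  · subst hy; rw [swap_reflect]
    exact hG.card_nb_swap h.reflect
  by_cases hz : v = z
  · subst hz; rw [swap_rotate]
    exact hG.card_nb_swap h.rotate
  by_cases hw : v = w
  · subst hw; rw [swap_rotate, swap_reflect]
    exact hG.card_nb_swap h.rotate.reflect
  rw [← hG v]
  congr 1
  ext q
  simp only [mem_nb, swap_adj h]
  grind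

theorem Reach.reg (h : Reach G G') (hG : Reg G d) : Reg G' d := by
  induction h with
  | refl => exact hG
  | tail _ hs ih =>
    obtain ⟨x, y, z, w, ha, rfl⟩ := hs.exists_alt
    exact ih.swap ha

open Classical in
/-- The number of edges in which two graphs differ. -/
noncomputable def dist (G H : SimpleGraph V) : ℕ :=
  (Finset.univ.filter fun e => ¬ (e ∈ G.edgeSet ↔ e ∈ H.edgeSet)).card

theorem dist_comm (G H : SimpleGraph V) : dist G H = dist H G := by
  unfold dist
  congr 1
  ext e
  simp only [Finset.mem_filter, Finset.mem_univ, true_and, iff_comm]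

/-- The switch repairs the two differences `va` and `vb`. By `hc`, the changes at `bc` and `ac` are
not both wrong, so at most one new difference arises. -/
theorem dist_swap_lt {v a b c : V} (hA : Alt G v a c b) (hva : ¬ H.Adj v a) (hvb : H.Adj v b)
    (hc : ¬ (H.Adj b c ∧ ¬ H.Adj a c)) : dist (swap G v a c b) H < dist G H := by
  classical
  set D := Finset.univ.filter fun e => ¬ (e ∈ G.edgeSet ↔ e ∈ H.edgeSet) with hD
  have hab := hA.hyw
  have h0 := hA.xy
  have h1 := hA.zw
  have h2 := hA.yz
  have h3 := hA.wx
  have h4 := hA.hyz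
  have h5 := hA.hwx
  have hcv := hA.hxz
  have hn1 := h0.ne
  have hn2 := h1.ne
  have key : ∃ f, (Finset.univ.filter fun e =>
      ¬ (e ∈ (swap G v a c b).edgeSet ↔ e ∈ H.edgeSet)) ⊆
      insert f ((D.erase s(v, a)).erase s(b, v)) := by
    have q1 : s(v, a) ≠ s(b, v) := by simp; grind
    have q2 : s(a, c) ≠ s(v, a) := by simp; grind
    have q3 : s(a, c) ≠ s(b, v) := by simp; grind
    have q4 : s(c, b) ≠ s(v, a) := by simp; grind
    have q5 : s(c, b) ≠ s(b, v) := by simp; grind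
    have q6 : s(c, b) ≠ s(a, c) := by simp; grind
    rw [SimpleGraph.adj_comm] at hvb
    rw [H.adj_comm b c] at hc
    simp only [← SimpleGraph.mem_edgeSet] at h0 h1 h2 h3 hva hvb hc
    by_cases hh : s(c, b) ∈ H.edgeSet
    · refine ⟨s(c, b), fun e => ?_⟩
      simp only [edgeSet_swap hA, hD, Finset.mem_filter, Finset.mem_univ, true_and, Finset.mem_insert,
        Finset.mem_erase, Set.mem_union, Set.mem_sdiff, Set.mem_insert_iff, Set.mem_singleton_iff]
      grind
    · refine ⟨s(a, c), fun e => ?_⟩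
      simp only [edgeSet_swap hA, hD, Finset.mem_filter, Finset.mem_univ, true_and, Finset.mem_insert,
        Finset.mem_erase, Set.mem_union, Set.mem_sdiff, Set.mem_insert_iff, Set.mem_singleton_iff]
      grind
  obtain ⟨f, hf⟩ := key
  have hm1 : s(v, a) ∈ D := by
    simp [hD, h0, hva]
  have hm2 : s(b, v) ∈ D.erase s(v, a) := by
    have : s(b, v) ≠ s(v, a) := by simp; grind
    simp [hD, h3, hvb.symm, this]
  have c1 := Finset.card_le_card hf
  have c2 := Finset.card_insert_le f ((D.erase s(v, a)).erase s(b, v))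
  have c3 := Finset.card_erase_add_one hm1
  have c4 := Finset.card_erase_add_one hm2
  have : dist G H = D.card := rfl
  rw [this, dist]
  omega

theorem Reg.exists_adj_not_adj (hG : Reg G d) (hH : Reg H d) {v : V} (hv : nb G v ≠ nb H v) :
    ∃ a, G.Adj v a ∧ ¬ H.Adj v a := by
  by_contra! hcon
  refine hv (Finset.eq_of_subset_of_card_le (fun a ha => mem_nb.2 (hcon a (mem_nb.1 ha))) ?_)
  rw [hG, hH]

/-- Since `a` and `b` have equal degrees, the sum over `c` of `[c ~ a] - [c ~ b]` (edge `ab`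
ignored) vanishes in both graphs. At `v` this term is larger in `G` than in `H`, so at some other
`c` it is smaller in `G`. That `c` closes a 4-cycle in one of the two graphs. -/
theorem Reg.exists_fourth (hG : Reg G d) (hH : Reg H d) {v a b : V} (h1 : G.Adj v a)
    (h2 : ¬ H.Adj v a) (h3 : ¬ G.Adj v b) (h4 : H.Adj v b) :
    ∃ c, c ≠ v ∧ c ≠ a ∧ c ≠ b ∧
      ((G.Adj b c ∧ ¬ G.Adj a c ∧ ¬ (H.Adj b c ∧ ¬ H.Adj a c)) ∨
      (H.Adj a c ∧ ¬ H.Adj b c ∧ ¬ (G.Adj a c ∧ ¬ G.Adj b c))) := by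
  classical
  by_contra! hcon
  let f (K : SimpleGraph V) (c : V) : ℤ :=
    (if c ∈ (nb K a).erase b then 1 else 0) - (if c ∈ (nb K b).erase a then 1 else 0)
  have hsum (K : SimpleGraph V) (hK : Reg K d) : ∑ c, f K c = 0 := by
    simp only [f, Finset.sum_sub_distrib, Finset.sum_ite_mem, Finset.univ_inter, Finset.sum_const]
    by_cases hab : K.Adj a b
    · have e1 := Finset.card_erase_add_one (mem_nb.2 hab)
      have e2 := Finset.card_erase_add_one (mem_nb.2 hab.symm)
      rw [hK] at e1 e2
      simp
      omega
    · rw [Finset.erase_eq_of_notMem (fun h => hab (mem_nb.1 h)),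
        Finset.erase_eq_of_notMem (fun h => hab (mem_nb.1 h).symm), hK, hK]
      simp
  have hab : a ≠ b := by rintro rfl; exact h3 h1
  have hz : ∑ c, (f G c - f H c) = 0 := by
    rw [Finset.sum_sub_distrib, hsum G hG, hsum H hH, sub_zero]
  have hnn : ∀ c ∈ Finset.univ, 0 ≤ (f G c - f H c) := by
    intro c _
    have hc := hcon c
    simp only [f, Finset.mem_erase, mem_nb]
    by_cases e1 : c = v
    · subst e1
      rw [G.adj_comm] at h1 h3
      rw [H.adj_comm] at h2 h4
      simp [h1, h2, h3, h4]
      grind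
    by_cases e2 : c = a
    · subst e2; simp
    by_cases e3 : c = b
    · subst e3; simp
    specialize hc e1 e2 e3
    grind
  have := (Finset.sum_eq_zero_iff_of_nonneg hnn).1 hz v (Finset.mem_univ _)
  rw [G.adj_comm] at h1 h3
  rw [H.adj_comm] at h2 h4
  simp only [f, Finset.mem_erase, mem_nb, h1, h2, h3, h4] at this
  have := h1.ne
  have := h4.ne
  grind

/-- Two distinct `d`-regular graphs can be brought closer by a switch in one of them, on vertices
at which they differ. -/
theorem Reg.exists_closer (hG : Reg G d) (hH : Reg H d) (hne : G ≠ H) :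
    ∃ x y z w, nb G x ≠ nb H x ∧ nb G y ≠ nb H y ∧ nb G z ≠ nb H z ∧ nb G w ≠ nb H w ∧
      ((Alt G x y z w ∧ dist (TriangleSwitch.swap G x y z w) H < dist G H) ∨
      (Alt H x y z w ∧ dist G (TriangleSwitch.swap H x y z w) < dist G H)) := by
  have differ {s t : V} (h : ¬ (G.Adj s t ↔ H.Adj s t)) : nb G s ≠ nb H s := fun e =>
    h (by rw [← mem_nb, ← mem_nb, e])
  obtain ⟨v, hv⟩ : ∃ v, nb G v ≠ nb H v := by
    by_contra! hcon
    refine hne ?_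
    ext s t
    rw [← mem_nb, ← mem_nb, hcon]
  obtain ⟨a, h1, h2⟩ := hG.exists_adj_not_adj hH hv
  obtain ⟨b, h4, h3⟩ := hH.exists_adj_not_adj hG hv.symm
  obtain ⟨c, hcv, hca, hcb, hc⟩ := hG.exists_fourth hH h1 h2 h3 h4
  have hc' : nb G c ≠ nb H c := by
    by_cases h : G.Adj c a ↔ H.Adj c a
    · refine differ (t := b) ?_
      rw [G.adj_comm c a, H.adj_comm c a] at h
      rw [G.adj_comm c b, H.adj_comm c b]
      grind
    · exact differ h
  have ha : nb G a ≠ nb H a := differ (t := v) (by rw [G.adj_comm, H.adj_comm]; grind)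
  have hb : nb G b ≠ nb H b := differ (t := v) (by rw [G.adj_comm, H.adj_comm]; grind)
  rcases hc with ⟨p1, p2, p3⟩ | ⟨p1, p2, p3⟩
  · have hA : Alt G v a c b := ⟨h1, p1.symm, p2, fun e => h3 e.symm, hca.symm, h4.ne'⟩
    exact ⟨v, a, c, b, hv, ha, hc', hb, .inl ⟨hA, dist_swap_lt hA h2 h4 p3⟩⟩
  · have hA : Alt H v b c a := ⟨h4, p1.symm, p2, fun e => h2 e.symm, hcb.symm, h1.ne'⟩
    refine ⟨v, b, c, a, hv, hb, hc', ha, .inr ⟨hA, ?_⟩⟩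
    rw [dist_comm G, dist_comm G]
    exact dist_swap_lt hA h3 h1 p3

/-- If all switches on a class of regular graphs (on the vertices where its members may differ) can
be realised by triangle switches, then any two members of the class are connected. -/
theorem reach_of_forall_alt {C : SimpleGraph V → Prop} {F : V → Prop}
    (hF : ∀ {G H : SimpleGraph V}, C G → C H → ∀ v, nb G v ≠ nb H v → F v)
    (hC : ∀ {G : SimpleGraph V}, Reg G d → C G → ∀ x y z w, F x → F y → F z → F w →
      Alt G x y z w → Reach G (swap G x y z w) ∧ C (swap G x y z w))
    (hG : Reg G d) (hH : Reg H d) (cG : C G) (cH : C H) : Reach G H := by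
  induction hn : dist G H using Nat.strong_induction_on generalizing G H with
  | _ n ih =>
    subst hn
    by_cases hne : G = H
    · exact hne ▸ Reach.refl G
    obtain ⟨x, y, z, w, hx, hy, hz, hw, ⟨hA, hlt⟩ | ⟨hA, hlt⟩⟩ := hG.exists_closer hH hne
    · obtain ⟨h1, h2⟩ := hC hG cG x y z w (hF cG cH x hx) (hF cG cH y hy) (hF cG cH z hz)
        (hF cG cH w hw) hA
      exact h1.trans (ih _ hlt (hG.swap hA) hH h2 cH rfl)
    · obtain ⟨h1, h2⟩ := hC hH cH x y z w (hF cG cH x hx) (hF cG cH y hy) (hF cG cH z hz)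
        (hF cG cH w hw) hA
      exact (ih _ hlt hG (hH.swap hA) cG h2 rfl).trans h1.symm

end

/-! ### Simulating an arbitrary switch by triangle switches -/

section

variable {V : Type*} {G G' H : SimpleGraph V}

theorem swap_comm {x y z w a b c e : V} (h : Alt G x y z w) (h' : Alt G a b c e)
    (h1 : Alt (swap G x y z w) a b c e) (h2 : Alt (swap G a b c e) x y z w) :
    swap (swap G x y z w) a b c e = swap (swap G a b c e) x y z w := by
  ext p q
  have ne {K : SimpleGraph V} {a b a' b' : V} (h1 : K.Adj a b) (h2 : ¬ K.Adj a' b') :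
      s(a, b) ≠ s(a', b') := fun e => h2 (by
    rwa [← SimpleGraph.mem_edgeSet, ← e, SimpleGraph.mem_edgeSet])
  have f1 := ne h.xy h'.yz
  have f2 := ne h.xy h'.wx
  have f3 := ne h.zw h'.yz
  have f4 := ne h.zw h'.wx
  have f5 := ne h'.xy h.yz
  have f6 := ne h'.xy h.wx
  have f7 := ne h'.zw h.yz
  have f8 := ne h'.zw h.wx
  rw [swap_adj' h1, swap_adj' h2, swap_adj' h, swap_adj' h']
  grind

/-- A switch whose diagonal `xz` lies in a triangle with some other vertex can be realised by
triangle switches. -/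
theorem Alt.reach_of_diagonal {x y z w v t : V} (h : Alt G x y z w) (hxz : G.Adj x z)
    (hvx : G.Adj v x) (hvz : G.Adj v z) (hty : G.Adj t y) (hvy : ¬ G.Adj v y)
    (htx : ¬ G.Adj t x) (hv : v ≠ y) (hvw : v ≠ w) (ht : t ≠ x) (htz : t ≠ z) (htw : t ≠ w) :
    Reach G (swap G x y z w) := by
  have a1 := h.xy
  have a2 := h.zw
  have a3 := h.yz
  have a4 := h.wx
  have n1 := h.hyz
  have n2 := h.hwx
  have n3 := h.hxz
  have n4 := h.hyw
  have n5 := h.xy.ne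
  have n6 := h.zw.ne
  have n7 := hvx.ne
  have n8 := hvz.ne
  have n9 := hty.ne
  have n10 : v ≠ t := by rintro rfl; exact hvy hty
  -- An auxiliary break switch on the triangle `v x z` makes `v` a common neighbour of `y` and `z`.
  -- The desired switch is then a make switch, and the auxiliary one, which commutes with it, is
  -- undone.
  have hB : Alt G v x t y :=
    ⟨hvx, hty, fun e => htx e.symm, fun e => hvy e.symm, ht.symm, hv.symm⟩
  have h1 : Alt (swap G v x t y) x y z w := by
    constructor <;> (try rw [swap_adj hB]) <;> grind
  have h2 : Alt (swap G x y z w) v x t y := by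
    constructor <;> (try rw [swap_adj h]) <;> grind [SimpleGraph.adj_comm]
  have r1 := hB.reach_break (v := z) hvz.symm hxz.symm htz.symm n1.symm
  have r2 := h2.reach_break (v := z) (by rw [swap_adj h]; grind [SimpleGraph.adj_comm])
    (by rw [swap_adj h]; grind [SimpleGraph.adj_comm]) htz.symm n1.symm
  have r3 := h1.reflect.reach_make (v := v) (by rw [swap_adj hB]; grind)
    (by rw [swap_adj hB]; grind) n7 hvw
  rw [swap_comm h hB h2 h1] at r2
  rw [← swap_reflect _ x y z w] at r3
  exact (r1.trans r3).trans r2.symm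

theorem Alt.reach_of_consecutive {x y z w v : V} (h : Alt G x y z w)
    (hv : v ≠ x ∧ v ≠ y ∧ v ≠ z ∧ v ≠ w)
    (hc : (G.Adj x v ∧ G.Adj y v) ∨ (G.Adj y v ∧ G.Adj z v) ∨ (G.Adj z v ∧ G.Adj w v) ∨
      (G.Adj w v ∧ G.Adj x v)) : Reach G (swap G x y z w) := by
  obtain ⟨hx, hy, hz, hw⟩ := hv
  rcases hc with ⟨h1, h2⟩ | ⟨h1, h2⟩ | ⟨h1, h2⟩ | ⟨h1, h2⟩
  · exact h.reach_break h1.symm h2.symm hz hw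
  · rw [swap_reflect]
    exact h.reflect.reach_make h1.symm h2.symm hx hw
  · rw [swap_rotate]
    exact h.rotate.reach_break h1.symm h2.symm hx hy
  · exact h.reach_make h2.symm h1.symm hy hz

/-- A switch can be realised by triangle switches with the help of two triangles `uij`, `uik`
away from its vertices. -/
theorem Alt.reach_of_hub {a b c e u i j k : V} (h : Alt G a b c e) (hi : G.Adj u i)
    (hj : G.Adj u j) (hk : G.Adj u k) (hij : G.Adj i j) (hik : G.Adj i k) (hjk : j ≠ k)
    (hia : ¬ G.Adj i a) (hic : ¬ G.Adj i c) (hjb : ¬ G.Adj j b) (hke : ¬ G.Adj k e)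
    (hu : u ≠ a ∧ u ≠ b ∧ u ≠ c ∧ u ≠ e) (hi' : i ≠ a ∧ i ≠ b ∧ i ≠ c ∧ i ≠ e)
    (hj' : j ≠ a ∧ j ≠ b ∧ j ≠ c ∧ j ≠ e) (hk' : k ≠ a ∧ k ≠ b ∧ k ≠ c ∧ k ≠ e) :
    Reach G (swap G a b c e) := by
  have a1 := h.xy
  have a2 := h.zw
  have a3 := h.yz
  have a4 := h.wx
  have n1 := h.hyz
  have n2 := h.hwx
  have n3 := h.hxz
  have n4 := h.hyw
  have n5 := h.xy.ne
  have n6 := h.zw.ne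
  have n7 := hi.ne
  have n8 := hj.ne
  have n9 := hk.ne
  have n10 := hij.ne
  have n11 := hik.ne
  -- Two break switches trade `ij`, `ab` for `jb`, `ai` and `ik`, `ce` for `ke`, `ci`. Two make
  -- switches then trade `ia`, `ek` for `ae`, `ki` and `ic`, `bj` for `cb`, `ji`, restoring both
  -- triangles.
  have A1 : Alt G i j b a := ⟨hij, a1.symm, hjb, fun e => hia e.symm, hj'.2.1, hi'.1.symm⟩
  have A2 : Alt (swap G i j b a) i k e c := by
    constructor <;> (try rw [swap_adj A1]) <;> grind [SimpleGraph.adj_comm]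
  have A3 : Alt (swap (swap G i j b a) i k e c) i a e k := by
    constructor <;> (try rw [swap_adj A2, swap_adj A1]) <;> grind [SimpleGraph.adj_comm]
  have A4 : Alt (swap (swap (swap G i j b a)
      i k e c) i a e k) i c b j := by
    constructor <;> (try rw [swap_adj A3, swap_adj A2, swap_adj A1]) <;>
      grind [SimpleGraph.adj_comm]
  have e : swap (swap (swap (swap
      G i j b a) i k e c) i a e k) i c b j = swap G a b c e := by
    ext s t
    rw [swap_adj' A4, swap_adj' A3, swap_adj' A2, swap_adj' A1, swap_adj' h]
    have hne {s t s' t' : V} (h : s ≠ s') (h' : s ≠ t') : s(s, t) ≠ s(s', t') := by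
      simp only [ne_eq, Sym2.eq_iff]; grind
    have m1 : s(i, j) ∈ G.edgeSet := hij
    have m2 : s(i, k) ∈ G.edgeSet := hik
    have m3 : s(a, b) ∈ G.edgeSet := a1
    have m4 : s(c, e) ∈ G.edgeSet := a2
    have o1 : s(a, i) ∉ G.edgeSet := fun e => hia (G.adj_symm e)
    have o2 : s(j, b) ∉ G.edgeSet := hjb
    have o3 : s(c, i) ∉ G.edgeSet := fun e => hic (G.adj_symm e)
    have o4 : s(k, e) ∉ G.edgeSet := hke
    have o5 : s(b, c) ∉ G.edgeSet := a3
    have o6 : s(e, a) ∉ G.edgeSet := a4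
    rw [Sym2.eq_swap (a := b) (b := a), Sym2.eq_swap (a := e) (b := c),
      Sym2.eq_swap (a := i) (b := a), Sym2.eq_swap (a := e) (b := k),
      Sym2.eq_swap (a := k) (b := i), Sym2.eq_swap (a := i) (b := c),
      Sym2.eq_swap (a := b) (b := j), Sym2.eq_swap (a := j) (b := i),
      Sym2.eq_swap (a := a) (b := e), Sym2.eq_swap (a := c) (b := b)]
    have q1 : s(i, j) ≠ s(i, k) := by simp [hjk, n11]
    have q2 : s(i, j) ≠ s(a, b) := hne hi'.1 hi'.2.1
    have q3 : s(i, j) ≠ s(c, e) := hne hi'.2.2.1 hi'.2.2.2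
    have q4 : s(i, k) ≠ s(a, b) := hne hi'.1 hi'.2.1
    have q5 : s(i, k) ≠ s(c, e) := hne hi'.2.2.1 hi'.2.2.2
    have q6 : s(a, b) ≠ s(c, e) := hne n3 n2.symm
    have q7 : s(a, i) ≠ s(c, i) := by simp [n3, hi'.1.symm]
    have q8 : s(j, b) ≠ s(k, e) := by simp [hjk, hj']
    rw [← SimpleGraph.mem_edgeSet]
    have q9 : s(a, i) ≠ s(k, e) := fun h => by
      have := congrArg (i ∈ ·) h; simp [hi', n11] at this
    have q10 : s(a, i) ≠ s(j, b) := fun h => by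
      have := congrArg (i ∈ ·) h; simp [hi', n10] at this
    have q11 : s(c, i) ≠ s(k, e) := fun h => by
      have := congrArg (i ∈ ·) h; simp [hi', n11] at this
    have q12 : s(c, i) ≠ s(j, b) := fun h => by
      have := congrArg (i ∈ ·) h; simp [hi', n10] at this
    have hmm {x : V} {p q : Sym2 V} (h : x ∉ p) (h' : x ∈ q) : p ≠ q := fun e => h (e ▸ h')
    have r1 : s(b, c) ≠ s(a, i) := hmm (x := i) (by simp [hi']) (by simp)
    have r2 : s(b, c) ≠ s(c, i) := hmm (x := i) (by simp [hi']) (by simp)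
    have r3 : s(b, c) ≠ s(j, b) := hmm (x := j) (by simp [hj']) (by simp)
    have r4 : s(b, c) ≠ s(k, e) := hmm (x := k) (by simp [hk']) (by simp)
    have r5 : s(e, a) ≠ s(a, i) := hmm (x := i) (by simp [hi']) (by simp)
    have r6 : s(e, a) ≠ s(c, i) := hmm (x := i) (by simp [hi']) (by simp)
    have r7 : s(e, a) ≠ s(j, b) := hmm (x := j) (by simp [hj']) (by simp)
    have r8 : s(e, a) ≠ s(k, e) := hmm (x := k) (by simp [hk']) (by simp)
    generalize s(s, t) = f at *
    generalize s(i, j) = e1, s(i, k) = e2, s(a, b) = e3, s(c, e) = e4, s(a, i) = f1,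
      s(j, b) = f2, s(c, i) = f3, s(k, e) = f4, s(b, c) = f5, s(e, a) = f6 at *
    clear * - m1 m2 m3 m4 o1 o2 o3 o4 o5 o6 q1 q2 q3 q4 q5 q6 q7 q8 q9 q10 q11 q12
      r1 r2 r3 r4 r5 r6 r7 r8
    by_cases hf : f ∈ G.edgeSet
    · have : f ≠ f1 ∧ f ≠ f2 ∧ f ≠ f3 ∧ f ≠ f4 ∧ f ≠ f5 ∧ f ≠ f6 := by
        refine ⟨?_, ?_, ?_, ?_, ?_, ?_⟩ <;> rintro rfl <;> contradiction
      simp only [hf, this, or_false, true_and]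
      grind
    · have : f ≠ e1 ∧ f ≠ e2 ∧ f ≠ e3 ∧ f ≠ e4 := by
        refine ⟨?_, ?_, ?_, ?_⟩ <;> rintro rfl <;> contradiction
      simp only [hf, this, or_false, false_and, false_or]
      grind
  rw [← e]
  refine (A1.reach_break hi hj hu.2.1 hu.1).trans <|
    (A2.reach_break (v := u) ?_ ?_ hu.2.2.2 hu.2.2.1).trans <|
    (A3.reach_make (v := u) ?_ ?_ hu.1 hu.2.2.2).trans <|
    A4.reach_make (v := u) ?_ ?_ hu.2.2.1 hu.2.1
  · rw [swap_adj A1]; grind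
  · rw [swap_adj A1]; grind
  · rw [swap_adj A2, swap_adj A1]; grind
  · rw [swap_adj A2, swap_adj A1]; grind
  · rw [swap_adj A3, swap_adj A2, swap_adj A1]; grind
  · rw [swap_adj A3, swap_adj A2, swap_adj A1]; grind

/-! ### Graphs on at most `2d + 1` vertices, and graphs with a common clique component -/

section Counting

variable [Fintype V] {d : ℕ}

theorem Reg.even (hG : Reg G d) : Even (Fintype.card V * d) := by
  classical
  have h := G.sum_degrees_eq_twice_card_edges
  have e : ∀ v, G.degree v = d := fun v => by
    rw [← hG v, ← G.card_neighborFinset_eq_degree]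
    congr 1
    ext w
    simp [mem_nb]
  simp only [e, Finset.sum_const, Finset.card_univ, smul_eq_mul] at h
  exact ⟨_, h.trans (two_mul _)⟩

/-- Otherwise consecutive vertices of the cycle have disjoint outside neighbourhoods, and so do the
ends of a diagonal that is an edge. With no diagonal this needs `2(d - 1) + 4` vertices, too many.
With a diagonal it needs at least `3(d - 2) + 4`, which leaves only `d = 3`, `n = 7`, where `nd` is
odd. -/
theorem Alt.reach_of_card_le (hd : 3 ≤ d) (hV : Fintype.card V ≤ 2 * d + 1) (hG : Reg G d)
    {x y z w : V} (h : Alt G x y z w) : Reach G (swap G x y z w) := by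
  classical
  by_contra hcon
  let ext (a b c : V) : Finset V := ((nb G a).erase b).erase c
  have hmem {a b c v : V} : v ∈ ext a b c ↔ v ≠ c ∧ v ≠ b ∧ G.Adj a v := by
    simp [ext, mem_nb]
  have card1 {a b c : V} (hb : G.Adj a b) (hc : ¬ G.Adj a c) : (ext a b c).card + 1 = d := by
    have : c ∉ (nb G a).erase b := by simp [mem_nb, hc]
    rw [← hG a, ← Finset.card_erase_add_one (mem_nb.2 hb)]
    simp only [ext, Finset.erase_eq_of_notMem this]
  have card2 {a b c : V} (hb : G.Adj a b) (hc : G.Adj a c) (hbc : b ≠ c) :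
      (ext a b c).card + 2 = d := by
    have : c ∈ (nb G a).erase b := by simp [mem_nb, hc, hbc.symm]
    rw [← hG a, ← Finset.card_erase_add_one (mem_nb.2 hb), ← Finset.card_erase_add_one this]
  have a1 := h.xy
  have a2 := h.zw
  have a3 := h.yz
  have a4 := h.wx
  have n1 := h.hyz
  have n2 := h.hwx
  have n3 := h.hxz
  have n4 := h.hyw
  have n5 := h.xy.ne
  have n6 := h.zw.ne
  have hc (v : V) (hv : v ≠ x ∧ v ≠ y ∧ v ≠ z ∧ v ≠ w) := fun e =>
    hcon (h.reach_of_consecutive (v := v) hv e)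
  have cX := @card1 x y z a1
  have cY := @card1 y x w a1.symm
  have cZ := @card1 z w x a2
  have cW := @card1 w z y a2.symm
  have cX' := fun e => @card2 x y z a1 e n1
  have cY' := fun e => @card2 y x w a1.symm e n2.symm
  have cZ' := fun e => @card2 z w x a2 e n2
  have cW' := fun e => @card2 w z y a2.symm e n1.symm
  have hX : ∀ v ∈ ext x y z, (v ≠ x ∧ v ≠ y ∧ v ≠ z ∧ v ≠ w) ∧ G.Adj x v := by
    intro v hv; have := hmem.1 hv; grind [SimpleGraph.adj_comm, SimpleGraph.irrefl]
  have hY : ∀ v ∈ ext y x w, (v ≠ x ∧ v ≠ y ∧ v ≠ z ∧ v ≠ w) ∧ G.Adj y v := by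
    intro v hv; have := hmem.1 hv; grind [SimpleGraph.adj_comm, SimpleGraph.irrefl]
  have hZ : ∀ v ∈ ext z w x, (v ≠ x ∧ v ≠ y ∧ v ≠ z ∧ v ≠ w) ∧ G.Adj z v := by
    intro v hv; have := hmem.1 hv; grind [SimpleGraph.adj_comm, SimpleGraph.irrefl]
  have hW : ∀ v ∈ ext w z y, (v ≠ x ∧ v ≠ y ∧ v ≠ z ∧ v ≠ w) ∧ G.Adj w v := by
    intro v hv; have := hmem.1 hv; grind [SimpleGraph.adj_comm, SimpleGraph.irrefl]
  have dXY : Disjoint (ext x y z) (ext y x w) := Finset.disjoint_left.2 fun v h1 h2 =>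
    hc v (hX v h1).1 (.inl ⟨(hX v h1).2, (hY v h2).2⟩)
  have dYZ : Disjoint (ext y x w) (ext z w x) := Finset.disjoint_left.2 fun v h1 h2 =>
    hc v (hY v h1).1 (.inr (.inl ⟨(hY v h1).2, (hZ v h2).2⟩))
  have dWX : Disjoint (ext w z y) (ext x y z) := Finset.disjoint_left.2 fun v h1 h2 =>
    hc v (hW v h1).1 (.inr (.inr (.inr ⟨(hW v h1).2, (hX v h2).2⟩)))
  have hE : (Finset.univ \ {x, y, z, w} : Finset V).card + 4 = Fintype.card V := by
    have : ({x, y, z, w} : Finset V).card = 4 := by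
      refine Finset.card_eq_four.2 ⟨x, y, z, w, n5, n3, n2.symm, n1, n4, n6, rfl⟩
    rw [← this, Finset.card_sdiff_add_card_eq_card (Finset.subset_univ _), Finset.card_univ]
  have sub (S : Finset V) (hS : ∀ v ∈ S, v ≠ x ∧ v ≠ y ∧ v ≠ z ∧ v ≠ w) :
      S.card + 4 ≤ Fintype.card V := by
    rw [← hE]
    gcongr
    intro v hv
    have := hS v hv
    simp [this]
  have pos (S : Finset V) (hS : S.card + 1 = d ∨ S.card + 2 = d) : ∃ t, t ∈ S :=
    Finset.card_pos.1 (by omega)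
  have dXZ (hxz : G.Adj x z) : Disjoint (ext x y z) (ext z w x) := by
    refine Finset.disjoint_left.2 fun v h1 h2 => hcon ?_
    obtain ⟨t, ht⟩ := pos (ext y x w) (by
      by_cases e : G.Adj y w
      exacts [.inr (cY' e), .inl (cY e)])
    obtain ⟨⟨-, v2, -, v4⟩, vx⟩ := hX v h1
    obtain ⟨⟨t1, -, t3, t4⟩, ty⟩ := hY t ht
    exact h.reach_of_diagonal (v := v) (t := t) hxz vx.symm (hZ v h2).2.symm ty.symm
      (fun e => hc v (hX v h1).1 (.inl ⟨vx, e.symm⟩))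
      (fun e => hc t (hY t ht).1 (.inl ⟨e.symm, ty⟩)) v2 v4 t1 t3 t4
  have dYW (hyw : G.Adj y w) : Disjoint (ext y x w) (ext w z y) := by
    refine Finset.disjoint_left.2 fun v h1 h2 => hcon ?_
    obtain ⟨t, ht⟩ := pos (ext x y z) (by
      by_cases e : G.Adj x z
      exacts [.inr (cX' e), .inl (cX e)])
    obtain ⟨⟨v1, -, v3, -⟩, vy⟩ := hY v h1
    obtain ⟨⟨-, t2, t3, t4⟩, tx⟩ := hX t ht
    rw [swap_reflect]
    exact h.reflect.reach_of_diagonal (v := v) (t := t) hyw vy.symm (hW v h2).2.symm tx.symm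
      (fun e => hc v (hY v h1).1 (.inl ⟨e.symm, vy⟩))
      (fun e => hc t (hX t ht).1 (.inl ⟨tx, e.symm⟩)) v1 v3 t2 t4 t3
  have odd (h3 : d = 3) (h7 : Fintype.card V = 7) : False := by
    have := hG.even
    rw [h3, h7] at this
    revert this
    decide
  by_cases hxz : G.Adj x z
  · have hd1 : Disjoint (ext x y z ∪ ext z w x) (ext y x w) :=
      Finset.disjoint_union_left.2 ⟨dXY, dYZ.symm⟩
    have := sub (ext x y z ∪ ext z w x ∪ ext y x w) (by
      intro v hv
      simp only [Finset.mem_union] at hv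
      obtain (hv | hv) | hv := hv
      exacts [(hX v hv).1, (hZ v hv).1, (hY v hv).1])
    rw [Finset.card_union_of_disjoint hd1, Finset.card_union_of_disjoint (dXZ hxz)] at this
    have := cX' hxz
    have := cZ' hxz.symm
    by_cases hyw : G.Adj y w
    · have := cY' hyw
      exact odd (by omega) (by omega)
    · have := cY hyw
      exact odd (by omega) (by omega)
  · by_cases hyw : G.Adj y w
    · have hd1 : Disjoint (ext y x w ∪ ext w z y) (ext x y z) :=
        Finset.disjoint_union_left.2 ⟨dXY.symm, dWX⟩
      have := sub (ext y x w ∪ ext w z y ∪ ext x y z) (by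
        intro v hv
        simp only [Finset.mem_union] at hv
        obtain (hv | hv) | hv := hv
        exacts [(hY v hv).1, (hW v hv).1, (hX v hv).1])
      rw [Finset.card_union_of_disjoint hd1, Finset.card_union_of_disjoint (dYW hyw)] at this
      have := cY' hyw
      have := cW' hyw.symm
      have := cX hxz
      exact odd (by omega) (by omega)
    · have := sub (ext x y z ∪ ext y x w) (by
        intro v hv
        simp only [Finset.mem_union] at hv
        obtain hv | hv := hv
        exacts [(hX v hv).1, (hY v hv).1])
      rw [Finset.card_union_of_disjoint dXY] at this
      have := cX hxz
      have := cY hyw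
      omega

theorem reach_of_card_le (hd : 3 ≤ d) (hV : Fintype.card V ≤ 2 * d + 1) (hG : Reg G d)
    (hH : Reg H d) : Reach G H :=
  reach_of_forall_alt (C := fun _ => True) (F := fun _ => True) (fun _ _ _ _ => trivial)
    (fun hG _ _ _ _ _ _ _ _ _ hA => ⟨hA.reach_of_card_le hd hV hG, trivial⟩) hG hH trivial trivial

/-- Two regular graphs with a common component that is a clique on at least four vertices are
connected. -/
theorem reach_of_common_clique {S : Finset V} (hS : 4 ≤ S.card) (hG : Reg G d) (hH : Reg H d)
    (cG : ∀ s ∈ S, ∀ t, G.Adj s t ↔ t ∈ S ∧ t ≠ s) (cH : ∀ s ∈ S, ∀ t, H.Adj s t ↔ t ∈ S ∧ t ≠ s) :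
    Reach G H := by
  classical
  refine reach_of_forall_alt (C := fun G => ∀ s ∈ S, ∀ t, G.Adj s t ↔ t ∈ S ∧ t ≠ s)
    (F := fun v => v ∉ S) ?_ ?_ hG hH cG cH
  · intro G H cG cH v hv hvS
    refine hv ?_
    ext t
    rw [mem_nb, mem_nb, cG v hvS, cH v hvS]
  · intro G _ cG x y z w hx hy hz hw hA
    obtain ⟨T, hTS, hT⟩ := Finset.exists_subset_card_eq hS
    obtain ⟨u, i, j, k, h1, h2, h3, h4, h5, h6, rfl⟩ := Finset.card_eq_four.1 hT
    have hu : u ∈ S := hTS (by simp)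
    have hi : i ∈ S := hTS (by simp)
    have hj : j ∈ S := hTS (by simp)
    have hk : k ∈ S := hTS (by simp)
    have hne {s t : V} (hs : s ∈ S) (ht : t ∉ S) : s ≠ t := fun e => ht (e ▸ hs)
    have hna {s t : V} (hs : s ∈ S) (ht : t ∉ S) : ¬ G.Adj s t := fun e => ht ((cG s hs t).1 e).1
    have ha {s t : V} (hs : s ∈ S) (ht : t ∈ S) (h : s ≠ t) : G.Adj s t := (cG s hs t).2 ⟨ht, h.symm⟩
    refine ⟨hA.reach_of_hub (ha hu hi h1) (ha hu hj h2) (ha hu hk h3) (ha hi hj h4) (ha hi hk h5)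
      h6 (hna hi hx) (hna hi hz) (hna hj hy) (hna hk hw) ⟨?_, ?_, ?_, ?_⟩ ⟨?_, ?_, ?_, ?_⟩
      ⟨?_, ?_, ?_, ?_⟩ ⟨?_, ?_, ?_, ?_⟩, fun s hs t => ?_⟩
    any_goals exact hne ‹_› ‹_›
    rw [swap_adj hA]
    have := hne hs hx
    have := hne hs hy
    have := hne hs hz
    have := hne hs hw
    grind

end Counting

end

/-! ### Making the neighbourhood of a vertex denser -/

section

variable {V : Type*} {G G' H : SimpleGraph V}

/-- Triangle switches can add an edge between neighbours of `u` while keeping all edges inside the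
closed neighbourhood of `u`. -/
def Grows (G : SimpleGraph V) (u : V) : Prop :=
  ∃ G', Reach G G' ∧
    (∀ s t, (s = u ∨ G.Adj u s) → (t = u ∨ G.Adj u t) → G.Adj s t → G'.Adj s t) ∧
    ∃ a b, G.Adj u a ∧ G.Adj u b ∧ ¬ G.Adj a b ∧ G'.Adj a b

/-- A make switch centred at `u`: the deleted edges `ay`, `zb` leave the closed neighbourhood of
`u`. -/
theorem grows_of_not_adj {u a b y z : V} (ha : G.Adj u a) (hb : G.Adj u b) (hab : a ≠ b)
    (hnab : ¬ G.Adj a b) (hya : G.Adj y a) (hzb : G.Adj z b) (hy : y ≠ u) (hyu : ¬ G.Adj u y)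
    (hz : z ≠ u) (hzu : ¬ G.Adj u z) (hyz : y ≠ z) (hnyz : ¬ G.Adj y z) : Grows G u := by
  have A : Alt G a y z b := ⟨hya.symm, hzb, hnyz, fun e => hnab e.symm, hyz, hab.symm⟩
  refine ⟨_, A.reach_make ha hb hy.symm hz.symm, fun s t hs ht hst => ?_, a, b, ha, hb, hnab, ?_⟩
  · rw [swap_adj A]; grind
  · rw [swap_adj A]; grind

/-- The first switch replaces the outside neighbour `y` of `a` by `p`, which is not joined to `z`,
so that the make switch centred at `u` becomes available. The case `y = z` is allowed. -/
theorem grows_of_slide {u a b y z p q : V} (A : Alt G a y q p) (hR : Reach G (swap G a y q p))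
    (ha : G.Adj u a) (hb : G.Adj u b) (hab : a ≠ b) (hnab : ¬ G.Adj a b)
    (hzb : G.Adj z b) (hy : y ≠ u) (hyu : ¬ G.Adj u y) (hz : z ≠ u) (hzu : ¬ G.Adj u z)
    (hp : p ≠ u) (hpu : ¬ G.Adj u p) (hpz : p ≠ z) (hnpz : ¬ G.Adj p z) : Grows G u := by
  have h1 := A.xy.ne
  have h2 := A.zw.ne
  have h3 := A.hyz
  have h4 := A.hwx
  have h5 := A.hxz
  have h6 := A.hyw
  have h7 := ha.ne
  have h8 := hb.ne
  have B : Alt (swap G a y q p) a p z b := by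
    constructor <;> (try rw [swap_adj A]) <;> grind [SimpleGraph.adj_comm]
  refine ⟨_, hR.trans (B.reach_make (v := u) ?_ ?_ hp.symm hz.symm), fun s t hs ht hst => ?_,
    a, b, ha, hb, hnab, ?_⟩
  · rw [swap_adj A]; grind
  · rw [swap_adj A]; grind
  · rw [swap_adj B, swap_adj A]; grind
  · rw [swap_adj B]; grind

theorem grows_of_adj {u a b c y z p q : V} (ha : G.Adj u a) (hb : G.Adj u b) (hc : G.Adj u c)
    (hca : G.Adj c a) (hab : a ≠ b) (hnab : ¬ G.Adj a b) (hya : G.Adj y a) (hzb : G.Adj z b)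
    (hy : y ≠ u) (hyu : ¬ G.Adj u y) (hz : z ≠ u) (hzu : ¬ G.Adj u z)
    (hp : p ≠ u) (hpu : ¬ G.Adj u p) (hq : q ≠ u) (hqu : ¬ G.Adj u q) (hpq : G.Adj p q)
    (hpz : p ≠ z) (hnpz : ¬ G.Adj p z) (hqy : q ≠ y) (hnqy : ¬ G.Adj q y) : Grows G u := by
  by_cases hpa : G.Adj p a
  · exact grows_of_not_adj ha hb hab hnab hpa hzb hp hpu hz hzu hpz hnpz
  have A : Alt G a y q p :=
    ⟨hya.symm, hpq.symm, fun e => hnqy e.symm, hpa, hqy.symm, fun e => hpu (e ▸ ha)⟩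
  refine grows_of_slide A (A.reach_slide ha.symm hca hc.symm hqu hy.symm hq.symm ?_ ?_)
    ha hb hab hnab hzb hy hyu hz hzu hp hpu hpz hnpz
  · rintro rfl; exact hyu hc
  · rintro rfl; exact hqu hc

variable [Fintype V] {d : ℕ}

/-- An extremal argument: among the vertices outside the closed neighbourhood of `u`, take `y` with
most neighbours in `nb G u`. If no edge can be added, maximality forces each neighbour of `u` joined
to `y` to have no other outside neighbour. This rigidity provides a slide that does add an edge. -/
theorem Reg.grows (hV : 2 * d + 2 ≤ Fintype.card V) (hG : Reg G d) {u c c' a₀ b₀ : V}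
    (hc : G.Adj u c) (hc' : G.Adj u c') (hcc : G.Adj c c') (ha₀ : G.Adj u a₀) (hb₀ : G.Adj u b₀)
    (hab₀ : a₀ ≠ b₀) (hnab₀ : ¬ G.Adj a₀ b₀) : Grows G u := by
  classical
  by_contra hcon
  have join {a b y z : V} (ha : G.Adj u a) (hb : G.Adj u b) (hab : a ≠ b) (hnab : ¬ G.Adj a b)
      (hya : G.Adj y a) (hzb : G.Adj z b) (hy : y ≠ u) (hyu : ¬ G.Adj u y)
      (hz : z ≠ u) (hzu : ¬ G.Adj u z) (hyz : y ≠ z) : G.Adj y z := by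
    by_contra hnyz
    exact hcon (grows_of_not_adj ha hb hab hnab hya hzb hy hyu hz hzu hyz hnyz)
  have near {a b y z p q : V} (ha : G.Adj u a) (hb : G.Adj u b) (hab : a ≠ b) (hnab : ¬ G.Adj a b)
      (hya : G.Adj y a) (hzb : G.Adj z b) (hy : y ≠ u) (hyu : ¬ G.Adj u y)
      (hz : z ≠ u) (hzu : ¬ G.Adj u z) (hiso : ∃ c, G.Adj u c ∧ (G.Adj c a ∨ G.Adj c b))
      (hp : p ≠ u) (hpu : ¬ G.Adj u p) (hq : q ≠ u) (hqu : ¬ G.Adj u q) (hpq : G.Adj p q)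
      (hpz : p ≠ z) (hnpz : ¬ G.Adj p z) : q = y ∨ G.Adj q y := by
    by_contra! hq'
    obtain ⟨c, hc, hca | hcb⟩ := hiso
    · exact hcon (grows_of_adj ha hb hc hca hab hnab hya hzb hy hyu hz hzu hp hpu hq hqu hpq hpz
        hnpz hq'.1 hq'.2)
    · exact hcon (grows_of_adj hb ha hc hcb hab.symm (fun e => hnab e.symm) hzb hya hz hzu hy hyu
        hq hqu hp hpu hpq.symm hq'.1 hq'.2 hpz hnpz)
  have far {z b : V} (hb : G.Adj u b) (hzb : G.Adj z b) :
      ∃ p, p ≠ u ∧ ¬ G.Adj u p ∧ p ≠ z ∧ ¬ G.Adj p z := by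
    -- `b` is counted in both neighbourhoods, so at most `2 + d + (d - 1) = 2d + 1` vertices are
    -- excluded.
    have h1 : (insert u (insert z (nb G u ∪ (nb G z).erase b))).card < Fintype.card V := by
      have := Finset.card_insert_le u (insert z (nb G u ∪ (nb G z).erase b))
      have := Finset.card_insert_le z (nb G u ∪ (nb G z).erase b)
      have := Finset.card_union_le (nb G u) ((nb G z).erase b)
      have := Finset.card_erase_add_one (mem_nb.2 hzb)
      have := hG u
      have := hG z
      omega
    rw [← Finset.card_univ] at h1
    obtain ⟨p, -, hp⟩ := Finset.exists_mem_notMem_of_card_lt_card h1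
    simp only [Finset.mem_insert, Finset.mem_union, Finset.mem_erase, mem_nb] at hp
    push Not at hp
    refine ⟨p, hp.1, hp.2.2.1, hp.2.1, fun h => ?_⟩
    by_cases hpb : p = b
    · exact hp.2.2.1 (hpb ▸ hb)
    · exact hp.2.2.2 hpb h.symm
  let α (y : V) : ℕ := (nb G y ∩ nb G u).card
  have hα (y : V) : (nb G y \ nb G u).card + α y = d := by
    rw [← hG y]
    exact Finset.card_sdiff_add_card_inter _ _
  -- Outside neighbours of `p` are equal or adjacent to `y`, so `p` has at most as many of them as
  -- `y`. If `y ≠ z`, then `z` is adjacent to `y` but not to `p`, and the count is strictly smaller.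
  have count {a b y z p : V} (ha : G.Adj u a) (hb : G.Adj u b) (hab : a ≠ b) (hnab : ¬ G.Adj a b)
      (hya : G.Adj y a) (hzb : G.Adj z b) (hy : y ≠ u) (hyu : ¬ G.Adj u y)
      (hz : z ≠ u) (hzu : ¬ G.Adj u z) (hiso : ∃ c, G.Adj u c ∧ (G.Adj c a ∨ G.Adj c b))
      (hp : p ≠ u) (hpu : ¬ G.Adj u p) (hpz : p ≠ z) (hnpz : ¬ G.Adj p z) :
      α y ≤ α p ∧ (y ≠ z → α y < α p) := by
    have hsub {q : V} (hq : q ∈ nb G p \ nb G u) : q = y ∨ G.Adj q y := by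
      rw [Finset.mem_sdiff, mem_nb, mem_nb] at hq
      refine near ha hb hab hnab hya hzb hy hyu hz hzu hiso hp hpu ?_ hq.2 hq.1 hpz hnpz
      rintro rfl
      exact hpu hq.1.symm
    have e1 := hα p
    have e2 := hα y
    by_cases hyz : y = z
    · subst hyz
      have : nb G p \ nb G u ⊆ nb G y \ nb G u := fun q hq => by
        have := hsub hq
        rw [Finset.mem_sdiff, mem_nb] at hq ⊢
        refine ⟨?_, hq.2⟩
        obtain rfl | h := this
        · exact absurd hq.1 hnpz
        · exact h.symm
      have := Finset.card_le_card this
      exact ⟨by omega, fun h => absurd rfl h⟩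
    · have hadj := join ha hb hab hnab hya hzb hy hyu hz hzu hyz
      have hz' : z ∈ nb G y \ nb G u := by simp [mem_nb, hadj, hzu]
      have c1 := Finset.card_erase_add_one hz'
      have hpy : p ≠ y := fun e => hnpz (e ▸ hadj)
      suffices (nb G p \ nb G u).card + 1 ≤ (nb G y \ nb G u).card from
        ⟨by omega, fun _ => by omega⟩
      by_cases hpy' : G.Adj p y
      · have hp' : p ∈ (nb G y \ nb G u).erase z := by simp [mem_nb, hpy'.symm, hpu, hpz]
        have c2 := Finset.card_erase_add_one hp'
        have : nb G p \ nb G u ⊆ insert y (((nb G y \ nb G u).erase z).erase p) := fun q hq => by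
          have := hsub hq
          rw [Finset.mem_sdiff, mem_nb] at hq
          rw [Finset.mem_insert, Finset.mem_erase, Finset.mem_erase, Finset.mem_sdiff, mem_nb]
          refine this.imp_right fun h => ⟨hq.1.ne', ?_, h.symm, hq.2⟩
          rintro rfl
          exact hnpz hq.1
        have := Finset.card_le_card this
        have := Finset.card_insert_le y (((nb G y \ nb G u).erase z).erase p)
        omega
      · have : nb G p \ nb G u ⊆ (nb G y \ nb G u).erase z := fun q hq => by
          have := hsub hq
          rw [Finset.mem_sdiff, mem_nb] at hq
          rw [Finset.mem_erase, Finset.mem_sdiff, mem_nb]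
          obtain rfl | h := this
          · exact absurd hq.1 hpy'
          refine ⟨?_, h.symm, hq.2⟩
          rintro rfl
          exact hnpz hq.1
        have := Finset.card_le_card this
        omega
  have exOut {a b : V} (ha : G.Adj u a) (hb : G.Adj u b) (hab : a ≠ b) (hnab : ¬ G.Adj a b) :
      ∃ y, G.Adj y a ∧ y ≠ u ∧ ¬ G.Adj u y := by
    by_contra! hno
    have hb' : b ∈ (nb G u).erase a := by simp [mem_nb, hb, hab.symm]
    have : nb G a ⊆ insert u (((nb G u).erase a).erase b) := fun y hy => by
      rw [mem_nb] at hy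
      rw [Finset.mem_insert, Finset.mem_erase, Finset.mem_erase, mem_nb]
      by_cases hyu : y = u
      · exact .inl hyu
      · exact .inr ⟨fun e => hnab (e ▸ hy), hy.ne', hno y hy.symm hyu⟩
    have := Finset.card_le_card this
    have := Finset.card_insert_le u (((nb G u).erase a).erase b)
    have := Finset.card_erase_add_one (mem_nb.2 ha)
    have := Finset.card_erase_add_one hb'
    have := hG a
    have := hG u
    omega
  have exMiss {a y : V} (ha : G.Adj u a) (hya : G.Adj y a) (hy : y ≠ u) (hyu : ¬ G.Adj u y) :
      ∃ b, G.Adj u b ∧ b ≠ a ∧ ¬ G.Adj a b := by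
    by_contra! hno
    have h1 : insert y (insert u ((nb G u).erase a)) ⊆ nb G a := fun b hb => by
      simp only [Finset.mem_insert, Finset.mem_erase, mem_nb] at hb ⊢
      rcases hb with rfl | rfl | hb
      · exact hya.symm
      · exact ha.symm
      · exact hno b hb.2 hb.1
    have := Finset.card_le_card h1
    have := Finset.card_erase_add_one (mem_nb.2 ha)
    rw [Finset.card_insert_of_notMem (by simp [mem_nb, hy, hyu]),
      Finset.card_insert_of_notMem (by simp [mem_nb])] at *
    have := hG a
    have := hG u
    omega
  have uniqueMiss {a y b b' : V} (ha : G.Adj u a)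
      (hu : ∀ z, G.Adj z a → z ≠ u → ¬ G.Adj u z → z = y)
      (hb : G.Adj u b) (hab : b ≠ a) (hnab : ¬ G.Adj a b)
      (hb' : G.Adj u b') (hab' : b' ≠ a) (hnab' : ¬ G.Adj a b') : b' = b := by
    by_contra hne
    have m1 : b ∈ (nb G u).erase a := by simp [mem_nb, hb, hab]
    have m2 : b' ∈ ((nb G u).erase a).erase b := by simp [mem_nb, hb', hab', hne]
    have : nb G a ⊆ insert y (insert u ((((nb G u).erase a).erase b).erase b')) := fun z hz => by
      rw [mem_nb] at hz
      simp only [Finset.mem_insert, Finset.mem_erase, mem_nb]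
      by_cases hzu : z = u
      · exact .inr (.inl hzu)
      by_cases huz : G.Adj u z
      · exact .inr (.inr ⟨fun e => hnab' (e ▸ hz), fun e => hnab (e ▸ hz), hz.ne', huz⟩)
      · exact .inl (hu z hz.symm hzu huz)
    have := Finset.card_le_card this
    have := Finset.card_insert_le y (insert u ((((nb G u).erase a).erase b).erase b'))
    have := Finset.card_insert_le u ((((nb G u).erase a).erase b).erase b')
    have := Finset.card_erase_add_one (mem_nb.2 ha)
    have := Finset.card_erase_add_one m1
    have := Finset.card_erase_add_one m2
    have := hG a
    have := hG u
    omega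
  obtain ⟨y₀, hy₀a, hy₀, hy₀u⟩ := exOut ha₀ hb₀ hab₀ hnab₀
  obtain ⟨y, hyO, hmax⟩ := Finset.exists_max_image
    (Finset.univ.filter fun y => y ≠ u ∧ ¬ G.Adj u y) α ⟨y₀, by simp [hy₀, hy₀u]⟩
  simp only [Finset.mem_filter, Finset.mem_univ, true_and] at hyO hmax
  obtain ⟨hy, hyu⟩ := hyO
  have hpos : 0 < α y := by
    refine lt_of_lt_of_le (Finset.card_pos.2 ⟨a₀, ?_⟩) (hmax y₀ ⟨hy₀, hy₀u⟩)
    simp [mem_nb, hy₀a, ha₀]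
  have unique {a : V} (ha : G.Adj u a) (hya : G.Adj y a) :
      (∀ z, G.Adj z a → z ≠ u → ¬ G.Adj u z → z = y) ∧
      ∃ b, G.Adj u b ∧ b ≠ a ∧ ¬ G.Adj a b ∧ G.Adj y b := by
    obtain ⟨b, hb, hba, hnab, hiso⟩ : ∃ b, G.Adj u b ∧ b ≠ a ∧ ¬ G.Adj a b ∧
        ∃ c, G.Adj u c ∧ (G.Adj c a ∨ G.Adj c b) := by
      by_cases h : ∃ c, G.Adj u c ∧ G.Adj c a
      · obtain ⟨e, he, hea⟩ := h
        obtain ⟨b, hb, hba, hnab⟩ := exMiss ha hya hy hyu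
        exact ⟨b, hb, hba, hnab, e, he, .inl hea⟩
      · push Not at h
        -- If `a` has no neighbour inside `nb G u`, the triangle `u c c'` supplies a missed vertex
        -- that has one.
        refine ⟨c, hc, ?_, fun e => h c hc e.symm, c', hc', .inr hcc.symm⟩
        rintro rfl
        exact h c' hc' hcc.symm
    have hB : ∀ z, G.Adj z b → z ≠ u → ¬ G.Adj u z → z = y := by
      intro z hzb hz hzu
      by_contra hzy
      obtain ⟨p, hp, hpu, hpz, hnpz⟩ := far hb hzb
      have := (count ha hb hba.symm hnab hya hzb hy hyu hz hzu hiso hp hpu hpz hnpz).2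
        (Ne.symm hzy)
      exact absurd (hmax p ⟨hp, hpu⟩) (by omega)
    obtain ⟨z, hzb, hz, hzu⟩ := exOut hb ha hba (fun e => hnab e.symm)
    obtain rfl := hB z hzb hz hzu
    refine ⟨fun y' hya' hy' hyu' => ?_, b, hb, hba, hnab, hzb⟩
    by_contra hne
    obtain ⟨p, hp, hpu, hpz, hnpz⟩ := far ha hya'
    have := (count hb ha hba (fun e => hnab e.symm) hzb hya' hy hyu hy' hyu'
      (hiso.imp fun _ h => ⟨h.1, h.2.symm⟩) hp hpu hpz hnpz).2 (Ne.symm hne)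
    exact absurd (hmax p ⟨hp, hpu⟩) (by omega)
  obtain ⟨a, ha'⟩ := Finset.card_pos.1 hpos
  obtain ⟨hya, ha⟩ : G.Adj y a ∧ G.Adj u a := by simpa [mem_nb] using ha'
  obtain ⟨hua, b, hb, hba, hnab, hyb⟩ := unique ha hya
  have hub := (unique hb hyb).1
  obtain ⟨p, hp, hpu, hpy, hnpy⟩ := far ha hya
  have hiso : ∃ c, G.Adj u c ∧ (G.Adj c a ∨ G.Adj c b) := by
    by_contra! hno
    have hac : a ≠ c := by rintro rfl; exact (hno c' hc').1 hcc.symm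
    have hac' : a ≠ c' := by rintro rfl; exact (hno c hc).1 hcc
    have e1 := uniqueMiss ha hua hb hba hnab hc hac.symm fun e => (hno c hc).1 e.symm
    have e2 := uniqueMiss ha hua hb hba hnab hc' hac'.symm fun e => (hno c' hc').1 e.symm
    exact hcc.ne (e1.trans e2.symm)
  -- Here `z = y`: the non-strict bound gives `p` a neighbour `q` in `nb G u`. Since `a` and `b`
  -- miss only each other, a vertex `e` missed by `q` is adjacent to `a`, and the triangle `a e u`
  -- carries the slide.
  have hle := (count ha hb hba.symm hnab hya hyb hy hyu hy hyu hiso hp hpu hpy hnpy).1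
  obtain ⟨q, hq'⟩ := Finset.card_pos.1 (hpos.trans_le hle)
  obtain ⟨hpq, hq⟩ : G.Adj p q ∧ G.Adj u q := by simpa [mem_nb] using hq'
  have hnyq : ¬ G.Adj y q := fun e => hpy ((unique hq e).1 p hpq hp hpu)
  have hqa : q ≠ a := by rintro rfl; exact hnyq hya
  have hqb : q ≠ b := by rintro rfl; exact hnyq hyb
  obtain ⟨e, he, heq, hnqe⟩ := exMiss hq hpq hp hpu
  have hea : e ≠ a := by
    rintro rfl
    exact hqb (uniqueMiss he hua hb hba hnab hq hqa fun h => hnqe h.symm)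
  have heb : e ≠ b := by
    rintro rfl
    exact hqa (uniqueMiss he hub ha hba.symm (fun h => hnab h.symm) hq hqb fun h => hnqe h.symm)
  have hae : G.Adj a e := by
    by_contra h
    exact heb (uniqueMiss ha hua hb hba hnab he hea h)
  have A : Alt G a y q p := by
    refine ⟨hya.symm, hpq.symm, hnyq, fun h => hpy (hua p h hp hpu), ?_, ?_⟩
    · rintro rfl; exact hyu hq
    · rintro rfl; exact hpu ha
  refine hcon (grows_of_slide A (A.reach_slide hae ha he (fun h => hnqe h.symm) ?_ heq hy.symm hq.ne)
    ha hb hba.symm hnab hyb hy hyu hy hyu hp hpu hpy hnpy)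
  rintro rfl
  exact hyu he

end

/-! ### Isolating a clique on a prescribed vertex set -/

section

variable {V : Type*} {G G' H : SimpleGraph V}

/-- `S` is a clique of `G` and a union of components. -/
def IsCliqueComponent (G : SimpleGraph V) (S : Finset V) : Prop :=
  ∀ s ∈ S, ∀ t, G.Adj s t ↔ t ∈ S ∧ t ≠ s

variable [Fintype V] {d : ℕ}

open Classical in
/-- Triangle switches can turn the closed neighbourhood of a vertex of a triangle into a clique. -/
theorem Reg.reach_cliqueComponent (hV : 2 * d + 2 ≤ Fintype.card V) (hG : Reg G d) {u c c' : V}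
    (hc : G.Adj u c) (hc' : G.Adj u c') (hcc : G.Adj c c') :
    ∃ G', Reach G G' ∧ IsCliqueComponent G' (insert u (nb G u)) := by
  induction hn : ((nb G u ×ˢ nb G u).filter fun p => ¬ G.Adj p.1 p.2).card
    using Nat.strong_induction_on generalizing G with
  | _ n ih =>
  subst hn
  by_cases h : ∀ a ∈ nb G u, ∀ b ∈ nb G u, a ≠ b → G.Adj a b
  · refine ⟨G, Reach.refl G, fun s hs => ?_⟩
    have e : (insert u (nb G u)).erase s = nb G s := by
      refine Finset.eq_of_subset_of_card_le (fun t ht => ?_) ?_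
      · simp only [Finset.mem_insert, Finset.mem_erase, mem_nb] at ht hs h ⊢
        obtain ⟨hts, rfl | ht⟩ := ht <;> obtain rfl | hs := hs
        · exact absurd rfl hts
        · exact hs.symm
        · exact ht
        · exact h s hs t ht hts.symm
      · have := Finset.card_erase_add_one hs
        rw [Finset.card_insert_of_notMem (by simp [mem_nb])] at this
        have := hG u
        have := hG s
        omega
    intro t
    rw [← mem_nb, ← e, Finset.mem_erase, and_comm]
  · push Not at h
    obtain ⟨a, ha, b, hb, hab, hnab⟩ := h
    obtain ⟨G₁, hR, hkeep, x, y, hx, hy, hnxy, hxy⟩ :=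
      hG.grows hV hc hc' hcc (mem_nb.1 ha) (mem_nb.1 hb) hab hnab
    have hG₁ := hR.reg hG
    -- The preserved edges at `u` already exhaust its degree.
    have e : nb G₁ u = nb G u := by
      refine (Finset.eq_of_subset_of_card_le (fun t ht => ?_) ?_).symm
      · rw [mem_nb] at ht ⊢
        exact hkeep u t (.inl rfl) (.inr ht) ht
      · rw [hG, hG₁]
    have hlt : ((nb G₁ u ×ˢ nb G₁ u).filter fun p => ¬ G₁.Adj p.1 p.2).card <
        ((nb G u ×ˢ nb G u).filter fun p => ¬ G.Adj p.1 p.2).card := by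
      rw [e]
      refine Finset.card_lt_card (Finset.ssubset_iff_of_subset (fun p hp => ?_) |>.2
        ⟨(x, y), by simp [mem_nb, hx, hy, hnxy], by simp [hxy]⟩)
      simp only [Finset.mem_filter, Finset.mem_product, mem_nb] at hp ⊢
      exact ⟨hp.1, fun h => hp.2 (hkeep _ _ (.inr hp.1.1) (.inr hp.1.2) h)⟩
    obtain ⟨G₂, hR₂, hS⟩ := ih _ hlt hG₁ (hkeep u c (.inl rfl) (.inr hc) hc)
      (hkeep u c' (.inl rfl) (.inr hc') hc') (hkeep c c' (.inr hc) (.inr hc') hcc) rfl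
    exact ⟨G₂, hR.trans hR₂, e ▸ hS⟩

/-- If neither `G` nor a make switch yields a triangle, every path on five vertices closes to a
5-cycle. For neighbours `x`, `w`, `t` of `v` and a further neighbour `z` of `w`, this joins `z` to
`w`, `t` and all neighbours of `x` but `v`: `d + 1` vertices, too many. -/
theorem Reg.exists_triangle (hd : 3 ≤ d) (hG : Reg G d) (v : V) :
    ∃ G', Reach G G' ∧ ∃ a b c, G'.Adj a b ∧ G'.Adj a c ∧ G'.Adj b c := by
  classical
  by_contra hcon
  have noTri {a b c : V} (h1 : G.Adj a b) (h2 : G.Adj a c) : ¬ G.Adj b c := fun h3 =>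
    hcon ⟨G, Reach.refl G, a, b, c, h1, h2, h3⟩
  have path {v x w y z : V} (hx : G.Adj v x) (hw : G.Adj v w) (hxw : x ≠ w) (hy : G.Adj x y)
      (hyv : y ≠ v) (hz : G.Adj w z) (hzv : z ≠ v) (hyz : y ≠ z) : G.Adj y z := by
    by_contra hnyz
    have A : Alt G x y z w := ⟨hy, hz.symm, hnyz, fun h => noTri hx hw h.symm, hyz, hxw.symm⟩
    refine hcon ⟨_, A.reach_make hx hw hyv.symm hzv.symm, v, x, w, ?_, ?_, ?_⟩ <;>
      rw [swap_adj A]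
    · exact .inl ⟨hx, by grind, by grind, by grind, by grind⟩
    · exact .inl ⟨hw, by grind, by grind, by grind, by grind⟩
    · simp
  obtain ⟨x, w, t, hx, hw, ht, hxw, hxt, hwt⟩ := Finset.two_lt_card_iff.1 (by
    rw [hG v]; omega : 2 < (nb G v).card)
  rw [mem_nb] at hx hw ht
  have exNb (a : V) (ha : G.Adj v a) (b : V) : ∃ y, G.Adj a y ∧ y ≠ v ∧ y ≠ b := by
    have h1 : 0 < (((nb G a).erase v).erase b).card := by
      have := Finset.pred_card_le_card_erase (s := (nb G a).erase v) (a := b)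
      have := Finset.pred_card_le_card_erase (s := nb G a) (a := v)
      have := hG a
      omega
    obtain ⟨y, hy⟩ := Finset.card_pos.1 h1
    simp only [Finset.mem_erase, mem_nb] at hy
    exact ⟨y, hy.2.2, hy.2.1, hy.1⟩
  obtain ⟨z, hz, hzv, -⟩ := exNb w hw w
  have hxz : ¬ G.Adj x z := fun hxz => by
    obtain ⟨y, hy, hyv, hyz⟩ := exNb x hx z
    exact noTri hy hxz (path hx hw hxw hy hyv hz hzv hyz)
  have hY (y : V) (hy : G.Adj x y) (hyv : y ≠ v) : G.Adj y z :=
    path hx hw hxw hy hyv hz hzv (by rintro rfl; exact hxz hy)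
  have htz : G.Adj t z := by
    obtain ⟨y, hy, hyv, -⟩ := exNb x hx x
    have hyx := hy.ne'
    refine path (v := x) (x := v) (w := y) hx.symm hy hyv.symm ht hxt.symm (hY y hy hyv) ?_ ?_
    · rintro rfl; exact noTri hx hw hz.symm
    · rintro rfl; exact noTri hw ht hz
  have hsub : insert w (insert t ((nb G x).erase v)) ⊆ nb G z := fun y hy => by
    simp only [Finset.mem_insert, Finset.mem_erase, mem_nb] at hy ⊢
    obtain rfl | rfl | ⟨hyv, hy⟩ := hy
    · exact hz.symm
    · exact htz.symm
    · exact (hY y hy hyv).symm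
  have hcard := Finset.card_le_card hsub
  have hw' : ¬ G.Adj x w := noTri hx hw
  have ht' : ¬ G.Adj x t := noTri hx ht
  rw [Finset.card_insert_of_notMem (by simp [mem_nb, hwt, hw']),
    Finset.card_insert_of_notMem (by simp [mem_nb, ht']),
    Finset.card_erase_add_one (mem_nb.2 hx.symm), hG, hG] at hcard
  omega

/-- A break switch gives some `u ∈ T` the neighbour `s ∈ S \ T` in place of `t ∈ T \ S` and spares a
triangle at `u`. Completing the neighbourhood of `u` again moves the clique component to `T - t +
s`, which is closer to `S`. -/
theorem Reg.reach_cliqueComponent_of_card_eq (hd : 3 ≤ d) (hV : 2 * d + 2 ≤ Fintype.card V)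
    (hG : Reg G d) {S T : Finset V} (hS : S.card = d + 1) (hT : T.card = d + 1)
    (hGT : IsCliqueComponent G T) : ∃ G', Reach G G' ∧ IsCliqueComponent G' S := by
  classical
  induction hn : (S \ T).card using Nat.strong_induction_on generalizing G T with
  | _ n ih =>
  subst hn
  by_cases h : S = T
  · exact ⟨G, Reach.refl G, h ▸ hGT⟩
  obtain ⟨s, hsS, hsT⟩ : ∃ s ∈ S, s ∉ T := by
    by_contra! hsub
    exact h (Finset.eq_of_subset_of_card_le hsub (by omega))
  obtain ⟨t, htT, htS⟩ : ∃ t ∈ T, t ∉ S := by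
    by_contra! hsub
    exact h (Finset.eq_of_subset_of_card_le hsub (by omega)).symm
  obtain ⟨u, c, c', hu, hc, hc', huc, huc', hcc⟩ := Finset.two_lt_card_iff.1 (by
    rw [Finset.card_erase_of_mem htT]; omega : 2 < (T.erase t).card)
  rw [Finset.mem_erase] at hu hc hc'
  obtain ⟨q, hq⟩ := Finset.card_pos.1 (by rw [hG s]; omega : 0 < (nb G s).card)
  rw [mem_nb] at hq
  have hqT : q ∉ T := fun hqT => hsT ((hGT q hqT s).1 hq.symm).1
  have adj {a b : V} (ha : a ∈ T) (hb : b ∈ T) (hab : a ≠ b) : G.Adj a b :=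
    (hGT a ha b).2 ⟨hb, hab.symm⟩
  have ne {a b : V} (ha : a ∈ T) (hb : b ∉ T) : a ≠ b := fun e => hb (e ▸ ha)
  have nadj {a b : V} (ha : a ∈ T) (hb : b ∉ T) : ¬ G.Adj a b := fun e => hb ((hGT a ha b).1 e).1
  have A : Alt G u t q s := ⟨adj hu.2 htT hu.1, hq.symm, nadj htT hqT,
    fun e => nadj hu.2 hsT e.symm, ne htT hqT, (ne hu.2 hsT).symm⟩
  have hR := A.reach_break (v := c) (adj hc.2 hu.2 huc.symm) (adj hc.2 htT hc.1) (ne hc.2 hqT)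
    (ne hc.2 hsT)
  have hG₁ := hR.reg hG
  have h1 := ne hu.2 hqT
  have h2 := ne hu.2 hsT
  have h3 := ne hc.2 hqT
  have h4 := ne hc.2 hsT
  have h5 := ne hc'.2 hqT
  have h6 := ne hc'.2 hsT
  have h7 := ne htT hsT
  have e : insert u (nb (TriangleSwitch.swap G u t q s) u) = insert s (T.erase t) := by
    ext b
    have := hGT u hu.2 b
    simp only [Finset.mem_insert, Finset.mem_erase, mem_nb, swap_adj A]
    grind
  obtain ⟨G₂, hR₂, hS₂⟩ := hG₁.reach_cliqueComponent hV (u := u) (c := c) (c' := c')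
    (by rw [swap_adj A]; have := adj hu.2 hc.2 huc; grind)
    (by rw [swap_adj A]; have := adj hu.2 hc'.2 huc'; grind)
    (by rw [swap_adj A]; have := adj hc.2 hc'.2 hcc; grind)
  have hS₂' : IsCliqueComponent G₂ (insert s (T.erase t)) := by
    rw [← e]
    convert hS₂
  have hlt : (S \ insert s (T.erase t)).card < (S \ T).card := by
    refine Finset.card_lt_card (Finset.ssubset_iff_of_subset (fun p hp => ?_) |>.2
      ⟨s, by simp [hsS, hsT], by simp⟩)
    simp only [Finset.mem_sdiff, Finset.mem_insert, Finset.mem_erase] at hp ⊢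
    refine ⟨hp.1, fun h => hp.2 (.inr ⟨?_, h⟩)⟩
    rintro rfl
    exact htS hp.1
  obtain ⟨G₃, hR₃, hS₃⟩ := ih _ hlt (hR₂.reg hG₁) (by
    rw [Finset.card_insert_of_notMem (by simp [hsT]), Finset.card_erase_add_one htT, hT]) hS₂' rfl
  exact ⟨G₃, (hR.trans hR₂).trans hR₃, hS₃⟩

theorem Reg.reach_cliqueComponent_on (hd : 3 ≤ d) (hV : 2 * d + 2 ≤ Fintype.card V)
    (hG : Reg G d) {S : Finset V} (hS : S.card = d + 1) :
    ∃ G', Reach G G' ∧ IsCliqueComponent G' S := by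
  classical
  obtain ⟨v, -⟩ := Finset.card_pos.1 (by omega : 0 < S.card)
  obtain ⟨G₁, hR₁, u, c, c', hc, hc', hcc⟩ := hG.exists_triangle hd v
  have hG₁ := hR₁.reg hG
  obtain ⟨G₂, hR₂, hT⟩ := hG₁.reach_cliqueComponent hV hc hc' hcc
  obtain ⟨G₃, hR₃, hS₃⟩ := (hR₂.reg hG₁).reach_cliqueComponent_of_card_eq hd hV hS (by
    rw [Finset.card_insert_of_notMem (by simp [mem_nb]), hG₁]) hT
  exact ⟨G₃, (hR₁.trans hR₂).trans hR₃, hS₃⟩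

/-- Any two `d`-regular graphs with `d ≥ 3` are connected by triangle switches. -/
theorem Reg.reach (hd : 3 ≤ d) (hG : Reg G d) (hH : Reg H d) : Reach G H := by
  by_cases hV : Fintype.card V ≤ 2 * d + 1
  · exact reach_of_card_le hd hV hG hH
  obtain ⟨S, -, hS⟩ := Finset.exists_subset_card_eq (s := (Finset.univ : Finset V)) (n := d + 1)
    (by rw [Finset.card_univ]; omega)
  obtain ⟨G', hG', cG⟩ := hG.reach_cliqueComponent_on hd (by omega) hS
  obtain ⟨H', hH', cH⟩ := hH.reach_cliqueComponent_on hd (by omega) hS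
  exact (hG'.trans (reach_of_common_clique (by omega) (hG'.reg hG) (hH'.reg hH) cG cH)).trans
    hH'.symm

/-! ### Transfer to the switch graph and to Markov chains -/

theorem reg_iff {n : ℕ} {G : SimpleGraph (Fin n)} {inst : G.LocallyFinite} :
    Reg G d ↔ G.IsRegularOfDegree d := by
  refine forall_congr' fun v => ?_
  rw [← G.card_neighborFinset_eq_degree]
  congr! 2
  ext w
  simp [mem_nb]

theorem switchGraph_reachable {n : ℕ} (hd : 3 ≤ d) (G H : RegularGraph n d) :
    (switchGraph n d).Reachable G H := by
  have key : ∀ K : SimpleGraph (Fin n), Reach G.1 K →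
      ∀ hK, (switchGraph n d).Reachable G ⟨K, hK⟩ := by
    intro K hR
    induction hR with
    | refl => exact fun _ => .refl _
    | @tail K L hGK hKL ih =>
      intro hL
      exact (ih (reg_iff.1 (Reach.reg hGK (reg_iff.2 G.2)))).trans
        (SimpleGraph.Adj.reachable (G := switchGraph n d) hKL)
  exact key H.1 (Reg.reach hd (reg_iff.2 G.2) (reg_iff.2 H.2)) H.2

theorem IsSwitchChain.isIrreducible {n : ℕ} {P : Matrix (RegularGraph n d) (RegularGraph n d) ℝ}
    (hP : IsSwitchChain P) (hconn : ∀ G H, (switchGraph n d).Reachable G H) :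
    P.IsIrreducible := by
  classical
  have hnn : ∀ i j, 0 ≤ P i j := hP.stochastic.1
  refine ⟨hnn, ?_⟩
  let := Matrix.toQuiver P
  have edge {G H : RegularGraph n d} (h : (switchGraph n d).Adj G H) : G ⟶ H :=
    PLift.up ((hP.pos_iff G H h.ne).2 h)
  have walk {G H : RegularGraph n d} (p : (switchGraph n d).Walk G H) :
      ∃ q : Quiver.Path G H, q.length = p.length := by
    induction p with
    | nil => exact ⟨.nil, rfl⟩
    | cons h p ih =>
      obtain ⟨q, hq⟩ := ih
      exact ⟨(edge h).toPath.comp q, by simp [hq, add_comm]⟩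
  intro G H
  -- Irreducibility asks for paths of positive length. From a state to itself this is a round trip
  -- through another state, or, with a single state, the loop whose probability is the row sum `1`.
  by_cases hGH : G = H
  · subst hGH
    by_cases hK : ∃ K, G ≠ K
    · obtain ⟨K, hK⟩ := hK
      obtain ⟨p⟩ := hconn G K
      obtain ⟨p'⟩ := hconn K G
      obtain ⟨q, hq⟩ := walk (p.append p')
      refine ⟨q, ?_⟩
      rw [hq, SimpleGraph.Walk.length_append]
      have : p.length ≠ 0 := fun h => hK (SimpleGraph.Walk.eq_of_length_eq_zero h)
      omega
    · push Not at hK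
      have hrow := (Matrix.mem_rowStochastic_iff_sum.1 hP.stochastic).2 G
      rw [Finset.sum_eq_single G (fun K _ h => absurd (hK K).symm h) (by simp)] at hrow
      have loop : G ⟶ G := PLift.up (by rw [hrow]; exact one_pos)
      exact ⟨loop.toPath, by simp⟩
  · obtain ⟨p⟩ := hconn G H
    obtain ⟨q, hq⟩ := walk p
    refine ⟨q, ?_⟩
    have : p.length ≠ 0 := fun h => hGH (SimpleGraph.Walk.eq_of_length_eq_zero h)
    omega

end

end TriangleSwitch

theorem theorem1 (n d : ℕ) (hd : 3 ≤ d) :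
    (Nonempty (TriangleSwitch.RegularGraph n d) → (TriangleSwitch.switchGraph n d).Connected) ∧
    (∀ P : Matrix (TriangleSwitch.RegularGraph n d) (TriangleSwitch.RegularGraph n d) ℝ,
      TriangleSwitch.IsSwitchChain P → P.IsIrreducible) :=
  ⟨fun _ => ⟨TriangleSwitch.switchGraph_reachable hd⟩,
    fun _ hP => hP.isIrreducible (TriangleSwitch.switchGraph_reachable hd)⟩
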